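/- Consider a wireless ad hoc network with slotted ALOHA access. Transmitters form a homogeneous Poisson point process of density $\lambda>0$ in the plane; each has a receiver at distance $d>0$, path-loss exponent $\alpha>2$, independent Rayleigh fading of a common scale, unit transmit power and no noise. In each slot, independently across transmitters, a unit of energy arrives with probability $p\in(0,1]$; it is stored in a battery of finite capacity $B\ge 1$, and a transmitter with a non-empty battery transmits with its own access probability $q\in[0,1]$, spending one unit. Thus the battery level is a birth–death chain on $\{0,\dots,B\}$: $0\to1$ has probability $p$, $i\to i+1$ has probability $p(1-q)$ for $1\le i<B$, $i\to i-1$ has probability $q(1-p)$ for $1\le i\le B$, and otherwise the level stays. Let $r(q)$ be the stationary probability of a non-empty battery; batteries are assumed stationary. A transmission succeeds if the signal-to-interference ratio at its receiver exceeds $\theta>0$, and a success carries rate $R>0$ (for instance $R=\log_2(1+\theta)$, or $R=1$ if throughput is measured in units of that rate). Let $\mathsf{TH}(q,\tilde q)=r(q)\,q\,\mathbb P(\mathsf{SIR}>\theta)\,R$ be the throughput of a typical transmitter that uses $q$ when all others use $\tilde q$, where $\mathsf{SIR}$ is computed with the other transmitters forming a Poisson process of density $\lambda$, each of them active when its battery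 is non-empty and it decides to access the channel. A symmetric Nash equilibrium (SNE) is $q^*\in[0,1]$ with $\mathsf{TH}(q^*,q^*)=\max_{q\in[0,1]}\mathsf{TH}(q,q^*)$, and the transmission capacity at $q^*$ is $C=\lambda\,\mathsf{TH}(q^*,q^*)$. Put $$\lambda_{\max}=\frac{1}{d^2\theta^{2/\alpha}\kappa(\alpha)},\qquad \kappa(\alpha)=\frac{2\pi^2}{\alpha\sin(2\pi/\alpha)}.$$ Then $q^*=1$ is an SNE, and at any SNE each transmitter's throughput is $$\mathsf{TH}=R\,p\exp\left(-\frac{p\lambda}{\lambda_{\max}}\right)$$ and the transmission capacity is $$C=R\,\lambda p\exp\left(-\frac{p\lambda}{\lambda_{\max}}\right).$$ -/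

import Mathlib

open MeasureTheory ProbabilityTheory Set
open scoped ENNReal NNReal

noncomputable section

namespace EHAloha

/-- The plane in which the nodes live; its `volume` is Lebesgue measure. -/
abbrev Plane : Type := EuclideanSpace ℝ (Fin 2)

/-! ### Poisson point processes and Rayleigh fading -/

/-- The number of points of the (enumerated) point process `X` that lie in `A`. -/
def pointCount {Ω : Type*} (X : ℕ → Ω → Plane) (A : Set Plane) (ω : Ω) : ℕ∞ :=
  {s : ℕ | X s ω ∈ A}.encard

/-- The random points `X 0, X 1, …` form a homogeneous Poisson point process of density `lam`:
the number of points in a Borel set of finite area is Poisson with mean `lam` times the area, and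
the numbers of points in disjoint Borel sets are independent. -/
structure IsPoissonPointProcess {Ω : Type*} [MeasurableSpace Ω] (μ : Measure Ω)
    (X : ℕ → Ω → Plane) (lam : ℝ) : Prop where
  measurable : ∀ s, Measurable (X s)
  count_law : ∀ A : Set Plane, MeasurableSet A → volume A ≠ ∞ →
    HasLaw (pointCount X A)
      ((poissonMeasure (lam.toNNReal * (volume A).toNNReal)).map (Nat.cast : ℕ → ℕ∞)) μ
  count_indep : ∀ (n : ℕ) (A : Fin n → Set Plane), (∀ i, MeasurableSet (A i)) →
    Pairwise (fun i j => Disjoint (A i) (A j)) → iIndepFun (fun i => pointCount X (A i)) μ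

/-- The Rayleigh distribution with scale `sigma`, of density
`x / sigma ^ 2 * exp (-x ^ 2 / (2 * sigma ^ 2))` on the positive half-line. -/
def rayleighMeasure (sigma : ℝ) : Measure ℝ :=
  volume.withDensity fun x =>
    ENNReal.ofReal (if 0 < x then x / sigma ^ 2 * Real.exp (-x ^ 2 / (2 * sigma ^ 2)) else 0)

/-! ### The energy queue -/

/-- Probability that the battery level goes from `i` to `i + 1` in one slot: energy arrives
(probability `p`), and no unit is spent (probability `1 - q`, or `1` if the battery is empty);
a full battery cannot grow. -/
def upProb (p q : ℝ) (B i : ℕ) : ℝ :=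
  if i = B then 0 else if i = 0 then p else p * (1 - q)

/-- Probability that the battery level goes from `i` to `i - 1` in one slot: one unit is spent on
a transmission (probability `q`) and no energy arrives (probability `1 - p`). -/
def downProb (p q : ℝ) (i : ℕ) : ℝ :=
  if i = 0 then 0 else q * (1 - p)

/-- Transition matrix of the birth-death chain on `{0, …, B}` followed by the energy in a battery
of capacity `B`, for energy arrival rate `p` and transmission probability `q`. -/
def queueMatrix (p q : ℝ) (B : ℕ) : Matrix (Fin (B + 1)) (Fin (B + 1)) ℝ :=
  fun i j =>
    if (j : ℕ) = i + 1 then upProb p q B i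
    else if (i : ℕ) = j + 1 then downProb p q i
    else if (i : ℕ) = j then 1 - upProb p q B i - downProb p q i
    else 0

/-- `v` is a stationary probability distribution of the energy queue. -/
def IsStationaryLaw (p q : ℝ) (B : ℕ) (v : Fin (B + 1) → ℝ) : Prop :=
  v ∈ stdSimplex ℝ (Fin (B + 1)) ∧ Matrix.vecMul v (queueMatrix p q B) = v

/-! ### The network -/

/-- Parameters of the network. -/
structure Params where
  /-- energy arrival rate of the Bernoulli harvesting process -/
  p : ℝ
  /-- battery capacity -/
  B : ℕ
  /-- density of the transmitters -/
  lam : ℝ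
  /-- distance between a transmitter and its receiver -/
  d : ℝ
  /-- path-loss exponent -/
  α : ℝ
  /-- SIR threshold for a successful transmission -/
  θ : ℝ
  /-- rate carried by a successful transmission -/
  R : ℝ
  /-- scale of the Rayleigh fading -/
  sigma : ℝ
  p_pos : 0 < p
  p_le_one : p ≤ 1
  one_le_B : 1 ≤ B
  lam_pos : 0 < lam
  d_pos : 0 < d
  two_lt_α : 2 < α
  θ_pos : 0 < θ
  R_pos : 0 < R
  sigma_pos : 0 < sigma

/-- `κ(α) = 2π² / (α sin (2π/α))`. -/
def Params.kappa (P : Params) : ℝ :=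
  2 * Real.pi ^ 2 / (P.α * Real.sin (2 * Real.pi / P.α))

/-- `λ_max = 1 / (d² θ^(2/α) κ(α))`. -/
def Params.lamMax (P : Params) : ℝ :=
  1 / (P.d ^ 2 * P.θ ^ (2 / P.α) * P.kappa)

/-- Received power over a link of length `x > 0` with fading coefficient `h`, at unit transmit
power (an interferer is almost surely not at distance `0`). -/
def Params.rxPower (P : Params) (x : ℝ) (h : ℂ) : ℝ≥0∞ :=
  ENNReal.ofReal (x ^ (-P.α) * ‖h‖ ^ 2)

/-- The network in a slot, seen from a typical transmitter located at the origin. The other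
transmitters (the interferers) form a Poisson process. The battery levels and access decisions
depend on the transmission probability `q` which the interferers use. -/
structure Network (P : Params) {Ω : Type*} [MeasurableSpace Ω] (μ : Measure Ω) where
  /-- location of the receiver of the typical transmitter -/
  receiver : Plane
  receiver_dist : dist (0 : Plane) receiver = P.d
  /-- locations of the interferers -/
  loc : ℕ → Ω → Plane
  loc_poisson : IsPoissonPointProcess μ loc P.lam
  /-- fading coefficient from the typical transmitter to its receiver -/
  ownFading : Ω → ℂ
  ownFading_measurable : Measurable ownFading
  ownFading_law : HasLaw (fun ω => ‖ownFading ω‖) (rayleighMeasure P.sigma) μ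
  /-- fading coefficients from the interferers to that receiver -/
  fading : ℕ → Ω → ℂ
  fading_measurable : ∀ s, Measurable (fading s)
  fading_law : ∀ s, HasLaw (fun ω => ‖fading s ω‖) (rayleighMeasure P.sigma) μ
  /-- stationary distribution of the battery level of a transmitter that uses `q` -/
  energyLaw : ℝ → Fin (P.B + 1) → ℝ
  energyLaw_stationary : ∀ q ∈ Icc (0 : ℝ) 1, IsStationaryLaw P.p q P.B (energyLaw q)
  /-- battery levels of the interferers when they all use `q` -/
  energy : ℝ → ℕ → Ω → Fin (P.B + 1)
  energy_measurable : ∀ q ∈ Icc (0 : ℝ) 1, ∀ s, Measurable (energy q s)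
  energy_law : ∀ q ∈ Icc (0 : ℝ) 1, ∀ s k, μ.real {ω | energy q s ω = k} = energyLaw q k
  /-- ALOHA access decisions of the interferers when they all use `q` -/
  access : ℝ → ℕ → Ω → Bool
  access_measurable : ∀ q ∈ Icc (0 : ℝ) 1, ∀ s, Measurable (access q s)
  access_law : ∀ q ∈ Icc (0 : ℝ) 1, ∀ s, μ.real {ω | access q s ω = true} = q
  /-- the locations are independent of everything else -/
  indep_loc : ∀ q ∈ Icc (0 : ℝ) 1,
    IndepFun (fun ω s => loc s ω)
      (fun ω => (ownFading ω, fun s => (fading s ω, energy q s ω, access q s ω))) μ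
  /-- the typical link's fading is independent of the fading and the activity of the others -/
  indep_ownFading : ∀ q ∈ Icc (0 : ℝ) 1,
    IndepFun ownFading (fun ω s => (fading s ω, energy q s ω, access q s ω)) μ
  /-- independence across the interferers -/
  indep_marks : ∀ q ∈ Icc (0 : ℝ) 1,
    iIndepFun (fun s ω => (fading s ω, energy q s ω, access q s ω)) μ
  /-- for each interferer, fading, battery level and access decision are independent -/
  indep_fading : ∀ q ∈ Icc (0 : ℝ) 1, ∀ s,
    IndepFun (fading s) (fun ω => (energy q s ω, access q s ω)) μ
  indep_access : ∀ q ∈ Icc (0 : ℝ) 1, ∀ s, IndepFun (energy q s) (access q s) μ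

namespace Network

variable {P : Params} {Ω : Type*} [MeasurableSpace Ω] {μ : Measure Ω}

/-- Interferer `s` transmits: it has energy and decides to access the channel. -/
def Transmits (N : Network P μ) (q : ℝ) (s : ℕ) (ω : Ω) : Prop :=
  1 ≤ (N.energy q s ω : ℕ) ∧ N.access q s ω = true

open Classical in
/-- Total interference at the receiver of the typical transmitter when the others use `q`. -/
def interference (N : Network P μ) (q : ℝ) (ω : Ω) : ℝ≥0∞ :=
  ∑' s, if N.Transmits q s ω then P.rxPower (dist (N.loc s ω) N.receiver) (N.fading s ω) else 0

/-- Signal to interference ratio of the typical link, with value `∞` if there is a signal and no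
interference. -/
def SIR (N : Network P μ) (q : ℝ) (ω : Ω) : ℝ≥0∞ :=
  P.rxPower P.d (N.ownFading ω) / N.interference q ω

/-- Success probability of the typical link when the other transmitters use `q`. -/
def successProb (N : Network P μ) (q : ℝ) : ℝ :=
  μ.real {ω | ENNReal.ofReal P.θ < N.SIR q ω}

/-- `r`, the probability that a transmitter using `q` has at least one unit of energy. -/
def activeProb (N : Network P μ) (q : ℝ) : ℝ :=
  ∑ k : Fin (P.B + 1), if 1 ≤ (k : ℕ) then N.energyLaw q k else 0

/-- `TH(q, q')`: throughput of a transmitter that uses `q` while all the others use `q'`. -/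
def throughput (N : Network P μ) (q q' : ℝ) : ℝ :=
  N.activeProb q * q * N.successProb q' * P.R

/-- Symmetric Nash equilibrium: `q` is a best reply in `[0, 1]` to everybody else using `q`. -/
def IsSNE (N : Network P μ) (q : ℝ) : Prop :=
  q ∈ Icc (0 : ℝ) 1 ∧ ∀ x ∈ Icc (0 : ℝ) 1, N.throughput x q ≤ N.throughput q q

/-- Transmission capacity when everybody uses `q`: the sum throughput per unit area. -/
def capacity (N : Network P μ) (q : ℝ) : ℝ :=
  P.lam * N.throughput q q

end Network

end EHAloha

end

noncomputable section

namespace EHAloha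

open Filter Topology

/-! A player's own access probability `x` enters the throughput only through the factor `r(x) x`,
the energy spent per slot. In a stationary battery the mean drift is zero, so `r(x) x = p - p (1 -
x) v_B`, where `v_B` is the probability of a full battery (`IsStationaryLaw.energy_balance`). Hence
`r(x) x ≤ p`, with equality at `x = 1`. The success probability is a positive factor that depends
only on what the others do, so `1` is a best reply to anything; conversely the deviation to `1`
forces `r(q) q = p` at every equilibrium. The stationary law is never solved for.

It remains to compute the success probability, a function of `a = r(q) q` alone
(`Network.successProb_eq`). The squared Rayleigh fading is exponential, so success has the
probability given by the Laplace transform of the interference at `θ d^α / (2σ²)`. Averaging over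
the marks, an interferer at distance `y` contributes the factor `1 - a + a / (1 + T y^(-α))` with `T
= θ d^α`. The Laplace functional of the Poisson process
(`IsPoissonPointProcess.lintegral_expNeg_tsum`) turns the product of these factors into `exp (-λ a ∫
T / (|x|^α + T) dx)`, and polar coordinates with the reflection formula for `Γ` give the integral as
`T^(2/α) κ(α)`.

Laplace transforms are taken with values in `[0, ∞]`, so the interference need not be shown finite.
-/

/-! ### The negative exponential on `[0, ∞]` -/

/-- `t ↦ e⁻ᵗ` on `[0, ∞]`, with `e^(-∞) = 0`. -/
def expNeg (t : ℝ≥0∞) : ℝ≥0∞ := EReal.exp (-(t : EReal))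

@[simp] lemma expNeg_zero : expNeg 0 = 1 := by simp [expNeg]

@[simp] lemma expNeg_top : expNeg ∞ = 0 := by simp [expNeg]

lemma expNeg_add (s t : ℝ≥0∞) : expNeg (s + t) = expNeg s * expNeg t := by
  simp only [expNeg, EReal.exp_neg, EReal.coe_ennreal_add, EReal.exp_add]
  refine ENNReal.mul_inv (Or.inl ?_) (Or.inr ?_) <;> simp

lemma expNeg_sum {ι : Type*} (s : Finset ι) (f : ι → ℝ≥0∞) :
    expNeg (∑ i ∈ s, f i) = ∏ i ∈ s, expNeg (f i) := by
  classical
  induction s using Finset.induction_on with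
  | empty => simp
  | insert a s ha ih => rw [Finset.sum_insert ha, Finset.prod_insert ha, expNeg_add, ih]

lemma expNeg_nat_mul (n : ℕ) (c : ℝ≥0∞) : expNeg (n * c) = expNeg c ^ n := by
  simpa using expNeg_sum (Finset.range n) fun _ => c

lemma continuous_expNeg : Continuous expNeg :=
  ENNReal.continuous_exp.comp (continuous_neg.comp continuous_coe_ennreal_ereal)

@[fun_prop] lemma measurable_expNeg : Measurable expNeg := continuous_expNeg.measurable

lemma antitone_expNeg : Antitone expNeg := fun s t h => by
  simpa [expNeg] using h

lemma expNeg_le_one (t : ℝ≥0∞) : expNeg t ≤ 1 := by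
  simpa using antitone_expNeg zero_le

lemma expNeg_ofReal {t : ℝ} (ht : 0 ≤ t) :
    expNeg (ENNReal.ofReal t) = ENNReal.ofReal (Real.exp (-t)) := by
  rw [expNeg, EReal.coe_ennreal_ofReal, max_eq_left ht, ← EReal.coe_neg, EReal.exp_coe]

/-- Any factor in `[0, 1]`, including `0`, has a logarithm here. This lets a product of per-point
factors be read as `expNeg` of a sum over the points, the form to which the Laplace functional
applies. -/
lemma exists_expNeg_eq {z : ℝ≥0∞} (hz : z ≤ 1) :
    expNeg (-ENNReal.log z).toENNReal = z := by
  have h : ENNReal.log z ≤ 0 := by simpa using ENNReal.log_monotone hz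
  rw [expNeg, EReal.coe_toENNReal (by simpa using h), neg_neg, ENNReal.exp_log]

lemma tendsto_lintegral_expNeg {Ω : Type*} [MeasurableSpace Ω] {μ : Measure Ω}
    [IsFiniteMeasure μ] {F : ℕ → Ω → ℝ≥0∞} {f : Ω → ℝ≥0∞} (hF : ∀ n, Measurable (F n))
    (h : ∀ ω, Tendsto (fun n => F n ω) atTop (𝓝 (f ω))) :
    Tendsto (fun n => ∫⁻ ω, expNeg (F n ω) ∂μ) atTop (𝓝 (∫⁻ ω, expNeg (f ω) ∂μ)) := by
  refine tendsto_lintegral_of_dominated_convergence (fun _ => 1)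
    (fun n => measurable_expNeg.comp (hF n)) (fun n => ae_of_all _ fun ω => expNeg_le_one _)
    (by simp) (ae_of_all _ fun ω => (continuous_expNeg.tendsto _).comp (h ω))

/-! ### The Laplace functional of a Poisson point process -/

/-- The Laplace transform of the Poisson distribution. -/
lemma lintegral_expNeg_poissonMeasure (m : ℝ≥0) (c : ℝ≥0∞) :
    ∫⁻ n : ℕ, expNeg (n * c) ∂(poissonMeasure m) = expNeg (m * (1 - expNeg c)) := by
  obtain ⟨z, hz⟩ : ∃ z : ℝ≥0, expNeg c = z :=
    ⟨(expNeg c).toNNReal, (ENNReal.coe_toNNReal ((expNeg_le_one c).trans_lt (by simp)).ne).symm⟩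
  have hz1 : z ≤ 1 := by simpa [hz] using expNeg_le_one c
  have hsum : HasSum (fun n : ℕ => Real.exp (-m) * ((z * m : ℝ) ^ n / n.factorial))
      (Real.exp (-m) * Real.exp (z * m)) := by
    refine HasSum.mul_left _ ?_
    rw [Real.exp_eq_exp_ℝ]
    exact NormedSpace.expSeries_div_hasSum_exp (z * m : ℝ)
  rw [lintegral_countable']
  have h1 : (1 : ℝ≥0∞) - z = ENNReal.ofReal (1 - z) := by
    rw [ENNReal.ofReal_sub _ z.coe_nonneg]; simp
  have h2 : (m : ℝ≥0∞) * (1 - z) = ENNReal.ofReal (m * (1 - z)) := by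
    rw [h1, ENNReal.ofReal_mul m.coe_nonneg]; simp
  have hz1' : (z : ℝ) ≤ 1 := by exact_mod_cast hz1
  rw [hz, h2, expNeg_ofReal (mul_nonneg m.coe_nonneg (by linarith))]
  have h3 : Real.exp (-(m * (1 - z))) = Real.exp (-m) * Real.exp (z * m) := by
    rw [← Real.exp_add]; congr 1; ring
  rw [h3, ← hsum.tsum_eq, ENNReal.ofReal_tsum_of_nonneg (fun n => by positivity) hsum.summable]
  refine tsum_congr fun n => ?_
  rw [expNeg_nat_mul, hz, poissonMeasure_singleton, ← ENNReal.ofReal_coe_nnreal,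
    ← ENNReal.ofReal_pow z.coe_nonneg, ← ENNReal.ofReal_mul (by positivity)]
  congr 1
  rw [mul_pow]; ring

lemma tsum_indicator_eq_pointCount_mul {Ω : Type*} (X : ℕ → Ω → Plane) (A : Set Plane)
    (c : ℝ≥0∞) (ω : Ω) : ∑' s, A.indicator (fun _ => c) (X s ω) = pointCount X A ω * c := by
  rw [pointCount, ← ENNReal.tsum_set_const, tsum_subtype {s : ℕ | X s ω ∈ A} fun _ => c]
  rfl

namespace IsPoissonPointProcess

variable {Ω : Type*} [MeasurableSpace Ω] {μ : Measure Ω} {X : ℕ → Ω → Plane} {lam : ℝ}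

lemma lintegral_expNeg_pointCount (hX : IsPoissonPointProcess μ X lam) {A : Set Plane}
    (hA : MeasurableSet A) (hv : volume A ≠ ∞) (c : ℝ≥0∞) :
    ∫⁻ ω, expNeg (pointCount X A ω * c) ∂μ =
      expNeg (ENNReal.ofReal lam * ((1 - expNeg c) * volume A)) := by
  have hm : Measurable fun n : ℕ∞ => expNeg (n * c) := measurable_of_countable _
  rw [(hX.count_law A hA hv).lintegral_comp hm.aemeasurable,
    lintegral_map hm (measurable_of_countable _)]
  simp only [ENat.toENNReal_coe]
  rw [lintegral_expNeg_poissonMeasure, ENNReal.coe_mul, ENNReal.coe_toNNReal hv]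
  congr 1
  rw [ENNReal.ofReal]; ring

lemma iIndepFun_pointCount (hX : IsPoissonPointProcess μ X lam) {ι : Type*} [Fintype ι]
    {A : ι → Set Plane} (hA : ∀ i, MeasurableSet (A i))
    (hd : Pairwise fun i j => Disjoint (A i) (A j)) :
    iIndepFun (fun i => pointCount X (A i)) μ := by
  have e := Fintype.equivFin ι
  have h := hX.count_indep _ (fun k => A (e.symm k)) (fun k => hA _)
    (fun i j hij => hd (e.symm.injective.ne hij))
  simpa using h.precomp e.injective

/-- The level sets are disjoint, so their counts are independent Poisson variables and the Laplace
transform factorises. Level `0` may have infinite area. -/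
lemma lintegral_expNeg_tsum_simpleFunc (hX : IsPoissonPointProcess μ X lam)
    (f : SimpleFunc Plane ℝ≥0∞) (hf : ∀ y ≠ 0, volume (f ⁻¹' {y}) ≠ ∞) :
    ∫⁻ ω, expNeg (∑' s, f (X s ω)) ∂μ =
      expNeg (ENNReal.ofReal lam * ∫⁻ x, (1 - expNeg (f x))) := by
  have hmeas : ∀ y : f.range, MeasurableSet (f ⁻¹' {(y : ℝ≥0∞)}) := fun y =>
    f.measurableSet_preimage _
  have hsplit : ∀ ω, ∑' s, f (X s ω) =
      ∑ y : f.range, pointCount X (f ⁻¹' {(y : ℝ≥0∞)}) ω * (y : ℝ≥0∞) := fun ω => by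
    simp_rw [← tsum_indicator_eq_pointCount_mul]
    rw [← Summable.tsum_finsetSum fun _ _ => ENNReal.summable]
    refine tsum_congr fun s => ?_
    rw [Finset.sum_eq_single (⟨f (X s ω), f.mem_range_self _⟩ : f.range)]
    · simp
    · intro b _ hb
      refine indicator_of_notMem (fun h => hb ?_) _
      exact Subtype.ext (by simpa using Eq.symm h)
    · simp
  have hind : iIndepFun
      (fun (y : f.range) ω => expNeg (pointCount X (f ⁻¹' {(y : ℝ≥0∞)}) ω * (y : ℝ≥0∞))) μ :=
    (hX.iIndepFun_pointCount hmeas fun i j hij =>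
    Disjoint.preimage _ (by simpa using fun h => hij (Subtype.ext h))).comp
      (fun y n => expNeg (n * (y : ℝ≥0∞))) fun _ => measurable_of_countable _
  simp_rw [hsplit, expNeg_sum]
  rw [lintegral_prod_eq_prod_lintegral_of_indepFun _ _ hind]
  · have hint : ∫⁻ x, (1 - expNeg (f x)) =
        ∑ y : f.range, (1 - expNeg y) * volume (f ⁻¹' {(y : ℝ≥0∞)}) := by
      have h := SimpleFunc.map_lintegral (μ := volume) (fun y => 1 - expNeg y) f
      rw [← SimpleFunc.lintegral_eq_lintegral] at h
      rw [Finset.sum_coe_sort f.range fun y => (1 - expNeg y) * volume (f ⁻¹' {y}), ← h]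
      rfl
    rw [hint, Finset.mul_sum, expNeg_sum]
    refine Finset.prod_congr rfl fun y _ => ?_
    by_cases hy : (y : ℝ≥0∞) = 0
    -- The level `0` contributes a factor `1` on both sides, provided `μ` has mass one; this is read
    -- off from the law of the number of points in the empty set.
    · have : IsProbabilityMeasure μ :=
        (hX.count_law ∅ .empty (by simp)).isProbabilityMeasure_iff.2
          (Measure.isProbabilityMeasure_map (measurable_of_countable _).aemeasurable)
      simp [hy]
    · exact hX.lintegral_expNeg_pointCount (hmeas y) (hf _ hy) _
  · intro y
    have : Measurable fun ω => ∑' s, (f ⁻¹' {(y : ℝ≥0∞)}).indicator (fun _ => (y : ℝ≥0∞)) (X s ω) :=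
      Measurable.tsum fun s =>
        (measurable_const.indicator (hmeas y)).comp (hX.measurable s)
    simp_rw [tsum_indicator_eq_pointCount_mul] at this
    exact measurable_expNeg.comp this

/-- The Laplace functional of a homogeneous Poisson point process. -/
theorem lintegral_expNeg_tsum [IsFiniteMeasure μ] (hX : IsPoissonPointProcess μ X lam)
    {g : Plane → ℝ≥0∞} (hg : Measurable g) :
    ∫⁻ ω, expNeg (∑' s, g (X s ω)) ∂μ =
      expNeg (ENNReal.ofReal lam * ∫⁻ x, (1 - expNeg (g x))) := by
  -- Simple functions increasing to `g`, cut off to balls so that the nonzero levels have finite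
  -- area.
  let f : ℕ → SimpleFunc Plane ℝ≥0∞ := fun n =>
    (SimpleFunc.eapprox g n).restrict (Metric.ball 0 n)
  have hball : ∀ n : ℕ, MeasurableSet (Metric.ball (0 : Plane) n) := fun n => measurableSet_ball
  have hf : ∀ n x, f n x = (Metric.ball (0 : Plane) n).indicator (SimpleFunc.eapprox g n) x :=
    fun n x => by rw [SimpleFunc.restrict_apply _ (hball n)]
  have hmono : ∀ x, Monotone fun n => f n x := fun x m n hmn => by
    simp only [hf]
    refine (indicator_le_indicator (SimpleFunc.monotone_eapprox g hmn x)).trans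
      (indicator_le_indicator_of_subset (Metric.ball_subset_ball (by exact_mod_cast hmn))
        (fun _ => zero_le) x)
  have hlim : ∀ x, Tendsto (fun n => f n x) atTop (𝓝 (g x)) := fun x => by
    have h := tendsto_atTop_iSup fun m n hmn => SimpleFunc.monotone_eapprox g hmn x
    rw [SimpleFunc.iSup_eapprox_apply hg] at h
    refine h.congr' ?_
    obtain ⟨N, hN⟩ := exists_nat_gt ‖x‖
    filter_upwards [eventually_ge_atTop N] with n hn
    rw [hf, indicator_of_mem]
    have : (N : ℝ) ≤ n := by exact_mod_cast hn
    simpa using hN.trans_le this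
  have hfin : ∀ n, ∀ y ≠ 0, volume (f n ⁻¹' {y}) ≠ ∞ := fun n y hy => by
    refine ((measure_mono ?_).trans_lt (measure_ball_lt_top (x := (0 : Plane)) (r := n))).ne
    intro x hx
    by_contra hxb
    refine hy ?_
    rw [← (by simpa using hx : f n x = y), hf, indicator_of_notMem hxb]
  have hsum : ∀ ω, Tendsto (fun n => ∑' s, f n (X s ω)) atTop (𝓝 (∑' s, g (X s ω))) := fun ω => by
    -- As integrals against counting measure, the sums converge by monotone convergence.
    simp_rw [← lintegral_count]
    exact lintegral_tendsto_of_tendsto_of_monotone (fun n => (measurable_of_countable _).aemeasurable)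
      (ae_of_all _ fun s => hmono _) (ae_of_all _ fun s => hlim _)
  have hL := tendsto_lintegral_expNeg (μ := μ)
    (fun n => Measurable.tsum fun s => (f n).measurable.comp (hX.measurable s)) hsum
  have hR : Tendsto (fun n => expNeg (ENNReal.ofReal lam * ∫⁻ x, (1 - expNeg (f n x)))) atTop
      (𝓝 (expNeg (ENNReal.ofReal lam * ∫⁻ x, (1 - expNeg (g x))))) := by
    refine (continuous_expNeg.tendsto _).comp
      (ENNReal.Tendsto.const_mul ?_ (Or.inr ENNReal.ofReal_ne_top))
    refine lintegral_tendsto_of_tendsto_of_monotone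
      (fun n => (measurable_const.sub (measurable_expNeg.comp (f n).measurable)).aemeasurable)
      (ae_of_all _ fun x m n hmn => tsub_le_tsub_left (antitone_expNeg (hmono x hmn)) _)
      (ae_of_all _ fun x => ?_)
    exact ENNReal.Tendsto.sub tendsto_const_nhds ((continuous_expNeg.tendsto _).comp (hlim x))
      (Or.inl (by simp))
  refine tendsto_nhds_unique (hL.congr fun n => ?_) hR
  exact hX.lintegral_expNeg_tsum_simpleFunc (f n) (hfin n)

end IsPoissonPointProcess

/-! ### Independent marks -/

section Independence

variable {Ω β γ : Type*} [MeasurableSpace Ω] [MeasurableSpace β] [MeasurableSpace γ]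
  {μ : Measure Ω} [IsFiniteMeasure μ]

/-- Fubini for independent random variables. -/
lemma lintegral_comp_of_indepFun {X : Ω → β} {Y : Ω → γ} (h : IndepFun X Y μ)
    (hX : Measurable X) (hY : Measurable Y) {f : β × γ → ℝ≥0∞} (hf : Measurable f) :
    ∫⁻ ω, f (X ω, Y ω) ∂μ = ∫⁻ ω, ∫⁻ ω', f (X ω, Y ω') ∂μ ∂μ := by
  have h' := (indepFun_iff_map_prod_eq_prod_map_map hX.aemeasurable hY.aemeasurable).1 h
  rw [← lintegral_map hf (hX.prodMk hY), h', lintegral_prod _ hf.aemeasurable,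
    lintegral_map hf.lintegral_prod_right' hX]
  refine lintegral_congr fun ω => ?_
  exact lintegral_map (hf.comp measurable_prodMk_left) hY

/-- The Laplace transform of a sum of independent random variables. -/
lemma lintegral_expNeg_tsum_of_iIndepFun {F : ℕ → Ω → ℝ≥0∞} (hF : ∀ s, Measurable (F s))
    (hind : iIndepFun F μ) {G : ℕ → ℝ≥0∞} (hG : ∀ s, ∫⁻ ω, expNeg (F s ω) ∂μ = expNeg (G s)) :
    ∫⁻ ω, expNeg (∑' s, F s ω) ∂μ = expNeg (∑' s, G s) := by
  have h1 := tendsto_lintegral_expNeg (μ := μ)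
    (fun n => Finset.measurable_sum (Finset.range n) fun s _ => hF s)
    (fun ω => by
      simpa using (ENNReal.summable (f := fun s => F s ω)).hasSum.tendsto_sum_nat)
  have h2 := (continuous_expNeg.tendsto _).comp
    (ENNReal.summable (f := G)).hasSum.tendsto_sum_nat
  refine tendsto_nhds_unique (h1.congr fun n => ?_) h2
  have hind' : iIndepFun (fun s ω => expNeg (F s ω)) μ :=
    hind.comp (fun _ => expNeg) fun _ => measurable_expNeg
  simp only [expNeg_sum, Function.comp]
  rw [lintegral_prod_eq_prod_lintegral_of_indepFun _ _ hind' fun s => measurable_expNeg.comp (hF s)]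
  exact Finset.prod_congr rfl fun s _ => hG s

end Independence

/-! ### The Rayleigh distribution -/

/-- Serves twice: `a = √t` gives the tail of a squared Rayleigh variable, and `a = 0` its Laplace
transform. -/
lemma lintegral_Ioi_mul_exp_neg_sq {b : ℝ} (hb : 0 < b) {a : ℝ} (ha : 0 ≤ a) :
    ∫⁻ x in Ioi a, ENNReal.ofReal (x * Real.exp (-(b * x ^ 2))) =
      ENNReal.ofReal (Real.exp (-(b * a ^ 2)) / (2 * b)) := by
  have hder : ∀ x : ℝ, HasDerivAt (fun x => -(Real.exp (-(b * x ^ 2)) / (2 * b)))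
      (x * Real.exp (-(b * x ^ 2))) x := fun x => by
    have h := ((((hasDerivAt_pow 2 x).const_mul b).neg.exp).div_const (2 * b)).neg
    refine h.congr_deriv ?_
    simp only [Pi.neg_apply]
    field_simp
    ring
  have hlim : Tendsto (fun x : ℝ => -(Real.exp (-(b * x ^ 2)) / (2 * b))) atTop (𝓝 0) := by
    have h : Tendsto (fun x : ℝ => b * x ^ 2) atTop atTop :=
      (tendsto_pow_atTop two_ne_zero).const_mul_atTop hb
    simpa using ((Real.tendsto_exp_neg_atTop_nhds_zero.comp h).div_const (2 * b)).neg
  have hnn : ∀ x ∈ Ioi a, 0 ≤ x * Real.exp (-(b * x ^ 2)) := fun x hx =>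
    mul_nonneg (ha.trans (le_of_lt hx)) (Real.exp_pos _).le
  have hcont := (hder a).continuousAt.continuousWithinAt (s := Ici a)
  have hint := integrableOn_Ioi_deriv_of_nonneg hcont (fun x _ => hder x) hnn hlim
  rw [← ofReal_integral_eq_lintegral_ofReal hint
    ((ae_restrict_iff' measurableSet_Ioi).2 (ae_of_all _ hnn)),
    integral_Ioi_of_hasDerivAt_of_tendsto hcont (fun x _ => hder x) hint hlim]
  simp

lemma lintegral_rayleighMeasure {sigma : ℝ} {f : ℝ → ℝ≥0∞} (hf : Measurable f) :
    ∫⁻ x, f x ∂(rayleighMeasure sigma) =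
      ∫⁻ x in Ioi 0, ENNReal.ofReal (x / sigma ^ 2 * Real.exp (-x ^ 2 / (2 * sigma ^ 2))) * f x := by
  rw [rayleighMeasure, lintegral_withDensity_eq_lintegral_mul _ _ hf,
    ← lintegral_indicator measurableSet_Ioi]
  · refine lintegral_congr fun x => ?_
    by_cases hx : 0 < x <;> simp [hx, indicator]
  · refine ENNReal.measurable_ofReal.comp (Measurable.ite measurableSet_Ioi ?_ measurable_const)
    fun_prop

/-- The square of a Rayleigh variable is exponential. -/
lemma rayleighMeasure_setOf_lt_sq {sigma t : ℝ} (hs : 0 < sigma) (ht : 0 ≤ t) :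
    rayleighMeasure sigma {x | t < x ^ 2} =
      ENNReal.ofReal (Real.exp (-(t / (2 * sigma ^ 2)))) := by
  have hm : MeasurableSet {x : ℝ | t < x ^ 2} := measurableSet_lt measurable_const (by fun_prop)
  rw [← lintegral_indicator_one hm, lintegral_rayleighMeasure (measurable_one.indicator hm)]
  have h := lintegral_Ioi_mul_exp_neg_sq (b := 1 / (2 * sigma ^ 2)) (by positivity)
    (Real.sqrt_nonneg t)
  have h1 : Real.exp (-(1 / (2 * sigma ^ 2) * √t ^ 2)) / (2 * (1 / (2 * sigma ^ 2))) =
      sigma ^ 2 * Real.exp (-(t / (2 * sigma ^ 2))) := by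
    rw [Real.sq_sqrt ht]; field_simp
  rw [h1] at h
  have h2 : ENNReal.ofReal (Real.exp (-(t / (2 * sigma ^ 2)))) = ENNReal.ofReal (1 / sigma ^ 2) *
      ENNReal.ofReal (sigma ^ 2 * Real.exp (-(t / (2 * sigma ^ 2)))) := by
    rw [← ENNReal.ofReal_mul (by positivity)]; congr 1; field_simp
  rw [h2, ← h, ← lintegral_const_mul _ (by fun_prop), ← lintegral_indicator measurableSet_Ioi,
    ← lintegral_indicator measurableSet_Ioi]
  refine lintegral_congr fun x => ?_
  by_cases hx : x ∈ Ioi (0 : ℝ)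
  · have hx' : 0 < x := hx
    have hiff : √t < x ↔ t < x ^ 2 := Real.sqrt_lt' hx'
    by_cases hxt : x ∈ {x | t < x ^ 2}
    · rw [indicator_of_mem hx, indicator_of_mem hxt, indicator_of_mem (show x ∈ Ioi √t from hiff.2 hxt),
        ← ENNReal.ofReal_mul (by positivity)]
      simp only [Pi.one_apply, mul_one]
      congr 1
      rw [show -x ^ 2 / (2 * sigma ^ 2) = -(1 / (2 * sigma ^ 2) * x ^ 2) by ring]
      ring
    · rw [indicator_of_mem hx, indicator_of_notMem hxt,
        indicator_of_notMem (show x ∉ Ioi √t from fun h => hxt (hiff.1 h)), mul_zero]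
  · rw [indicator_of_notMem hx,
      indicator_of_notMem (show x ∉ Ioi √t from fun h => hx ((Real.sqrt_nonneg t).trans_lt h))]

/-- The Laplace transform of the square of a Rayleigh variable. -/
lemma lintegral_expNeg_sq_rayleighMeasure {sigma c : ℝ} (hs : 0 < sigma) (hc : 0 ≤ c) :
    ∫⁻ x, expNeg (ENNReal.ofReal (c * x ^ 2)) ∂(rayleighMeasure sigma) =
      ENNReal.ofReal (1 / (1 + 2 * sigma ^ 2 * c)) := by
  have h := lintegral_Ioi_mul_exp_neg_sq (b := 1 / (2 * sigma ^ 2) + c) (by positivity) le_rfl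
  rw [lintegral_rayleighMeasure (by fun_prop)]
  have h2 : ENNReal.ofReal (1 / (1 + 2 * sigma ^ 2 * c)) = ENNReal.ofReal (1 / sigma ^ 2) *
      ENNReal.ofReal (Real.exp (-((1 / (2 * sigma ^ 2) + c) * 0 ^ 2)) /
        (2 * (1 / (2 * sigma ^ 2) + c))) := by
    rw [← ENNReal.ofReal_mul (by positivity)]; congr 1
    simp
    field_simp
  rw [h2, ← h, ← lintegral_const_mul _ (by fun_prop)]
  refine setLIntegral_congr_fun measurableSet_Ioi fun x hx => ?_
  have hx' : 0 < x := hx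
  rw [expNeg_ofReal (by positivity), ← ENNReal.ofReal_mul (by positivity),
    ← ENNReal.ofReal_mul (by positivity)]
  congr 1
  rw [show -((1 / (2 * sigma ^ 2) + c) * x ^ 2) = -x ^ 2 / (2 * sigma ^ 2) + -(c * x ^ 2) by ring,
    Real.exp_add]
  ring

/-! ### The interference integral -/

lemma lintegral_Ioi_rpow_mul_exp {a r : ℝ} (ha : 0 < a) (hr : 0 < r) :
    ∫⁻ t in Ioi (0 : ℝ), ENNReal.ofReal (t ^ (a - 1) * Real.exp (-(r * t))) =
      ENNReal.ofReal ((1 / r) ^ a * Real.Gamma a) := by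
  have h := Real.integral_rpow_mul_exp_neg_mul_Ioi ha hr
  have hpos : 0 < (1 / r) ^ a * Real.Gamma a :=
    mul_pos (Real.rpow_pos_of_pos (by positivity) _) (Real.Gamma_pos_of_pos ha)
  rw [← ofReal_integral_eq_lintegral_ofReal, h]
  -- Integrability comes from the value: a non-integrable function would have integral `0`, but the
  -- value is positive.
  · by_contra hn
    rw [integral_undef hn] at h
    exact hpos.ne h
  · refine (ae_restrict_iff' measurableSet_Ioi).2 (ae_of_all _ fun t ht => ?_)
    exact mul_nonneg (Real.rpow_nonneg (le_of_lt ht) _) (Real.exp_pos _).le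

lemma lintegral_Ioi_mul_exp_neg_rpow {α b : ℝ} (hα : 0 < α) (hb : 0 < b) :
    ∫⁻ y in Ioi (0 : ℝ), ENNReal.ofReal (y * Real.exp (-(b * y ^ α))) =
      ENNReal.ofReal (b ^ (-(2 / α)) * (1 / α * Real.Gamma (2 / α))) := by
  have h := integral_rpow_mul_exp_neg_mul_rpow (p := α) (q := 1) hα (by norm_num) hb
  have hG := Real.Gamma_pos_of_pos (show 0 < 2 / α by positivity)
  have hpos : 0 < b ^ (-(2 / α)) * (1 / α * Real.Gamma (2 / α)) :=
    mul_pos (Real.rpow_pos_of_pos hb _) (by positivity)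
  have h' : ∫ y in Ioi (0 : ℝ), y * Real.exp (-(b * y ^ α)) =
      b ^ (-(2 / α)) * (1 / α * Real.Gamma (2 / α)) := by
    simp only [Real.rpow_one, neg_mul] at h
    rw [h, show (1 : ℝ) + 1 = 2 by norm_num, neg_div]; ring
  rw [← ofReal_integral_eq_lintegral_ofReal, h']
  · by_contra hn
    rw [integral_undef hn] at h'
    exact hpos.ne h'
  · refine (ae_restrict_iff' measurableSet_Ioi).2 (ae_of_all _ fun t ht => ?_)
    exact mul_nonneg (le_of_lt ht) (Real.exp_pos _).le

/-- Write `1 / (y^α + T)` as `∫ exp (-(y^α + T) u) du` and exchange the integrals. The integral over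
`y` gives `Γ(2/α) u^(-2/α)`, the one over `u` gives `Γ(1 - 2/α)`, and reflection produces the sine.
Convergence at `u = 0` is where `α > 2` enters. -/
lemma lintegral_Ioi_div_rpow_add {α T : ℝ} (hα : 2 < α) (hT : 0 < T) :
    ∫⁻ y in Ioi (0 : ℝ), ENNReal.ofReal (y * (T / (y ^ α + T))) =
      ENNReal.ofReal (T ^ (2 / α) * (Real.pi / (α * Real.sin (2 * Real.pi / α)))) := by
  have hα0 : 0 < α := by linarith
  have h2α : 2 / α < 1 := by rw [div_lt_one hα0]; exact hα
  have hexp : ∀ y ∈ Ioi (0 : ℝ), ENNReal.ofReal (y * (T / (y ^ α + T))) =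
      ∫⁻ u in Ioi (0 : ℝ), ENNReal.ofReal (y * T * Real.exp (-((y ^ α + T) * u))) := by
    intro y hy
    have hy' : 0 < y := hy
    have h := lintegral_Ioi_rpow_mul_exp one_pos (show 0 < y ^ α + T by positivity)
    simp only [sub_self, Real.rpow_zero, one_mul, Real.rpow_one, Real.Gamma_one, mul_one] at h
    rw [show y * (T / (y ^ α + T)) = y * T * (1 / (y ^ α + T)) by ring,
      ENNReal.ofReal_mul (by positivity), ← h, ← lintegral_const_mul _ (by fun_prop)]
    exact lintegral_congr fun u => (ENNReal.ofReal_mul (by positivity)).symm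
  rw [setLIntegral_congr_fun measurableSet_Ioi hexp, lintegral_lintegral_swap (by fun_prop)]
  have hG := Real.Gamma_pos_of_pos (show 0 < 2 / α by positivity)
  have hG' := Real.Gamma_pos_of_pos (show 0 < 1 - 2 / α by linarith)
  have hin : ∀ u ∈ Ioi (0 : ℝ),
      ∫⁻ y in Ioi (0 : ℝ), ENNReal.ofReal (y * T * Real.exp (-((y ^ α + T) * u))) =
      ENNReal.ofReal (T * (1 / α * Real.Gamma (2 / α))) *
        ENNReal.ofReal (u ^ (1 - 2 / α - 1) * Real.exp (-(T * u))) := by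
    intro u hu
    have hu' : 0 < u := hu
    have h := lintegral_Ioi_mul_exp_neg_rpow hα0 hu'
    rw [← ENNReal.ofReal_mul (by positivity),
      show T * (1 / α * Real.Gamma (2 / α)) * (u ^ (1 - 2 / α - 1) * Real.exp (-(T * u))) =
        T * Real.exp (-(T * u)) * (u ^ (-(2 / α)) * (1 / α * Real.Gamma (2 / α))) by
        rw [show 1 - 2 / α - 1 = -(2 / α) by ring]; ring,
      ENNReal.ofReal_mul (by positivity), ← h, ← lintegral_const_mul _ (by fun_prop)]
    refine lintegral_congr fun y => ?_
    rw [← ENNReal.ofReal_mul (by positivity)]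
    congr 1
    rw [show -((y ^ α + T) * u) = -(T * u) + -(u * y ^ α) by ring, Real.exp_add]
    ring
  rw [setLIntegral_congr_fun measurableSet_Ioi hin, lintegral_const_mul _ (by fun_prop),
    lintegral_Ioi_rpow_mul_exp (by linarith) hT, ← ENNReal.ofReal_mul (by positivity)]
  congr 1
  have hrefl := Real.Gamma_mul_Gamma_one_sub (2 / α)
  have hT' : (1 / T) ^ (1 - 2 / α) = T ^ (2 / α) / T := by
    rw [one_div, Real.inv_rpow hT.le, ← Real.rpow_neg hT.le, neg_sub, Real.rpow_sub_one hT.ne']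
  calc _ = T * (1 / T) ^ (1 - 2 / α) / α * (Real.Gamma (2 / α) * Real.Gamma (1 - 2 / α)) := by ring
    _ = _ := by
      rw [hrefl, hT', show Real.pi * (2 / α) = 2 * Real.pi / α by ring]
      field_simp

/-- Polar coordinates for radial functions on the plane. -/
lemma lintegral_plane_norm {f : ℝ → ℝ} (hf : ∀ y, 0 < y → 0 ≤ f y) (hm : Measurable f)
    (hfin : ∫⁻ y in Ioi (0 : ℝ), ENNReal.ofReal (y * f y) ≠ ∞) :
    ∫⁻ x : Plane, ENNReal.ofReal (f ‖x‖) =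
      ENNReal.ofReal (2 * Real.pi) * ∫⁻ y in Ioi (0 : ℝ), ENNReal.ofReal (y * f y) := by
  have hnn : ∀ y ∈ Ioi (0 : ℝ), 0 ≤ y * f y := fun y hy => mul_nonneg (le_of_lt hy) (hf y hy)
  have hnn' := (ae_restrict_iff' (μ := volume) measurableSet_Ioi).2 (ae_of_all _ hnn)
  have hint : IntegrableOn (fun y => y * f y) (Ioi 0) := by
    refine (lintegral_ofReal_ne_top_iff_integrable (by fun_prop) hnn').1 hfin
  have hint2 : Integrable fun x : Plane => f ‖x‖ := by
    rw [integrable_fun_norm_addHaar]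
    simpa using hint
  have hne : ∀ᵐ x : Plane, 0 ≤ f ‖x‖ := by
    filter_upwards [compl_mem_ae_iff.2 (measure_singleton (0 : Plane))] with x hx
    exact hf _ (norm_pos_iff.2 hx)
  rw [← ofReal_integral_eq_lintegral_ofReal hint2 hne, integral_fun_norm_addHaar,
    ← ofReal_integral_eq_lintegral_ofReal hint hnn', ← ENNReal.ofReal_mul (by positivity)]
  congr 1
  -- The constant `2π` is the dimension times the area of the unit disc.
  simp [measureReal_def, EuclideanSpace.volume_ball_fin_two, ENNReal.toReal_ofReal Real.pi_pos.le,
    mul_assoc]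

/-! ### Energy balance in the battery -/

/-- The expected next level is the current one plus the drift. At the ends `B` and `0` the missing
neighbour does no harm, because its transition probability is zero. -/
lemma sum_queueMatrix_mul (p q : ℝ) (B : ℕ) (i : Fin (B + 1)) :
    ∑ j, queueMatrix p q B i j * ((j : ℕ) : ℝ) =
      (i : ℕ) + upProb p q B i - downProb p q i := by
  have hterm : ∀ j : Fin (B + 1), queueMatrix p q B i j * ((j : ℕ) : ℝ) =
      (if (j : ℕ) = i + 1 then upProb p q B i * ((i : ℕ) + 1) else 0) +
      (if (i : ℕ) = j + 1 then downProb p q i * ((i : ℕ) - 1) else 0) +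
      (if i = j then (1 - upProb p q B i - downProb p q i) * (i : ℕ) else 0) := by
    intro j
    unfold queueMatrix
    have hij : i = j ↔ (i : ℕ) = j := Fin.ext_iff
    by_cases h1 : (j : ℕ) = i + 1
    · have h2 : ¬ (i : ℕ) = j + 1 := by omega
      have h3 : ¬ (i : ℕ) = j := by omega
      rw [if_pos h1, if_pos h1, if_neg h2, if_neg (hij.not.2 h3), h1]
      push_cast; ring
    · by_cases h2 : (i : ℕ) = j + 1
      · have h3 : ¬ (i : ℕ) = j := by omega
        have h4 : ((j : ℕ) : ℝ) = (i : ℕ) - 1 := by rw [h2]; push_cast; ring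
        rw [if_neg h1, if_pos h2, if_neg h1, if_pos h2, if_neg (hij.not.2 h3), h4]; ring
      · by_cases h3 : (i : ℕ) = j <;> simp [hij, h1, h2, h3]
  have hup : ∑ j : Fin (B + 1), (if (j : ℕ) = i + 1 then upProb p q B i * ((i : ℕ) + 1) else 0) =
      upProb p q B i * ((i : ℕ) + 1) := by
    by_cases hi : (i : ℕ) = B
    · simp [upProb, hi]
    · rw [Finset.sum_eq_single ⟨i + 1, by omega⟩] <;> simp [Fin.ext_iff]
      intro b h h'; exact absurd h' h
  have hdown : ∑ j : Fin (B + 1), (if (i : ℕ) = j + 1 then downProb p q i * ((i : ℕ) - 1) else 0) =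
      downProb p q i * ((i : ℕ) - 1) := by
    by_cases hi : (i : ℕ) = 0
    · simp [downProb, hi]
    · rw [Finset.sum_eq_single ⟨i - 1, by omega⟩]
      · rw [if_pos (by simp; omega)]
      · intro b _ hb
        rw [if_neg]
        intro h
        exact hb (Fin.ext (by simp; omega))
      · simp
  simp_rw [hterm, Finset.sum_add_distrib]
  rw [hup, hdown, Finset.sum_ite_eq, if_pos (Finset.mem_univ _)]
  ring

/-- In equilibrium the energy spent per slot is the energy harvested minus the overflow. -/
lemma IsStationaryLaw.energy_balance {p q : ℝ} {B : ℕ} {v : Fin (B + 1) → ℝ}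
    (h : IsStationaryLaw p q B v) (hB : 1 ≤ B) :
    (∑ k : Fin (B + 1), if 1 ≤ (k : ℕ) then v k else 0) * q =
      p - p * (1 - q) * v (Fin.last B) := by
  obtain ⟨⟨-, hv1⟩, hst⟩ := h
  -- Stationarity preserves the mean level, so the mean drift vanishes.
  have hdrift : ∑ i, v i * (upProb p q B i - downProb p q i) = 0 := by
    have h1 : ∑ j : Fin (B + 1), v j * ((j : ℕ) : ℝ) =
        ∑ i, v i * ((i : ℕ) + upProb p q B i - downProb p q i) := by
      calc ∑ j : Fin (B + 1), v j * ((j : ℕ) : ℝ)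
          = ∑ j, Matrix.vecMul v (queueMatrix p q B) j * ((j : ℕ) : ℝ) := by rw [hst]
        _ = ∑ j, ∑ i, v i * (queueMatrix p q B i j * ((j : ℕ) : ℝ)) := by
          simp [Matrix.vecMul, dotProduct, Finset.sum_mul, mul_assoc]
        _ = _ := by
          rw [Finset.sum_comm]
          simp_rw [← Finset.mul_sum, sum_queueMatrix_mul]
    rw [← sub_eq_zero, ← Finset.sum_sub_distrib] at h1
    rw [← neg_eq_zero, ← h1, ← Finset.sum_neg_distrib]
    exact Finset.sum_congr rfl fun i _ => by ring
  -- At every level the drift is harvest `p`, minus `q` if the battery is non-empty, minus the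
  -- overflow `p (1 - q)` if it is full. Since `B ≥ 1`, empty and full are distinct.
  have hterm : ∀ i : Fin (B + 1), v i * (upProb p q B i - downProb p q i) =
      p * v i - q * (if 1 ≤ (i : ℕ) then v i else 0) -
        (if i = Fin.last B then p * (1 - q) * v i else 0) := by
    intro i
    have hl : i = Fin.last B ↔ (i : ℕ) = B := by simp [Fin.ext_iff]
    simp only [upProb, downProb, hl]
    rcases Nat.eq_zero_or_pos (i : ℕ) with h0 | h0
    · have : ¬ (0 = B) := by omega
      simp [h0, this]; ring
    · have h1 : (i : ℕ) ≠ 0 := by omega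
      by_cases hb : (i : ℕ) = B
      · have : B ≠ 0 := by omega
        simp [hb, this, hB]; ring
      · simp [hb, h1, Nat.one_le_iff_ne_zero]; ring
  simp_rw [hterm, Finset.sum_sub_distrib, ← Finset.mul_sum, hv1] at hdrift
  rw [Finset.sum_ite_eq' Finset.univ (Fin.last B), if_pos (Finset.mem_univ _)] at hdrift
  linarith

/-! ### Success probability -/

namespace Network

variable {P : Params} {Ω : Type*} [MeasurableSpace Ω] {μ : Measure Ω}

lemma activeProb_mul (N : Network P μ) {q : ℝ} (hq : q ∈ Icc (0 : ℝ) 1) :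
    N.activeProb q * q = P.p - P.p * (1 - q) * N.energyLaw q (Fin.last P.B) :=
  (N.energyLaw_stationary q hq).energy_balance P.one_le_B

lemma activeProb_one_mul (N : Network P μ) : N.activeProb 1 * 1 = P.p := by
  simpa using N.activeProb_mul (q := 1) (by simp)

lemma activeProb_mul_le (N : Network P μ) {q : ℝ} (hq : q ∈ Icc (0 : ℝ) 1) :
    N.activeProb q * q ≤ P.p := by
  rw [N.activeProb_mul hq]
  have h1 := (N.energyLaw_stationary q hq).1.1 (Fin.last P.B)
  have h2 := P.p_pos
  have h3 : 0 ≤ 1 - q := by linarith [hq.2]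
  have := mul_nonneg (mul_nonneg h2.le h3) h1
  linarith

lemma activeProb_mul_nonneg (N : Network P μ) {q : ℝ} (hq : q ∈ Icc (0 : ℝ) 1) :
    0 ≤ N.activeProb q * q := by
  refine mul_nonneg (Finset.sum_nonneg fun k _ => ?_) hq.1
  split_ifs
  · exact (N.energyLaw_stationary q hq).1.1 k
  · exact le_rfl

/-- Fading, battery level and access decision of interferer `s`. -/
def mark (N : Network P μ) (q : ℝ) (s : ℕ) (ω : Ω) : ℂ × Fin (P.B + 1) × Bool :=
  (N.fading s ω, N.energy q s ω, N.access q s ω)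

/-- Power received at `z` from an interferer at `x` with mark `m`. -/
def _root_.EHAloha.Params.markPower (P : Params) (z x : Plane)
    (m : ℂ × Fin (P.B + 1) × Bool) : ℝ≥0∞ :=
  if 1 ≤ (m.2.1 : ℕ) ∧ m.2.2 = true then P.rxPower (dist x z) m.1 else 0

lemma interference_eq (N : Network P μ) (q : ℝ) (ω : Ω) :
    N.interference q ω = ∑' s, P.markPower N.receiver (N.loc s ω) (N.mark q s ω) := by
  refine tsum_congr fun s => ?_
  simp only [Params.markPower, mark, Transmits]
  congr

lemma measurable_mark (N : Network P μ) {q : ℝ} (hq : q ∈ Icc (0 : ℝ) 1) (s : ℕ) :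
    Measurable (N.mark q s) :=
  (N.fading_measurable s).prodMk ((N.energy_measurable q hq s).prodMk (N.access_measurable q hq s))

lemma _root_.EHAloha.Params.measurable_markPower (P : Params) (z : Plane) :
    Measurable fun y : Plane × (ℂ × Fin (P.B + 1) × Bool) => P.markPower z y.1 y.2 := by
  refine Measurable.ite ?_ ?_ measurable_const
  · exact (measurable_snd.comp measurable_snd)
      (MeasurableSet.of_discrete (s := {m : Fin (P.B + 1) × Bool | 1 ≤ (m.1 : ℕ) ∧ m.2 = true}))
  · unfold Params.rxPower
    fun_prop

lemma measure_transmits (N : Network P μ) [IsProbabilityMeasure μ] {q : ℝ}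
    (hq : q ∈ Icc (0 : ℝ) 1) (s : ℕ) :
    μ {ω | N.Transmits q s ω} = ENNReal.ofReal (N.activeProb q * q) := by
  have h := (N.indep_access q hq s).measure_inter_preimage_eq_mul {k | 1 ≤ (k : ℕ)} {true}
    MeasurableSet.of_discrete MeasurableSet.of_discrete
  have he : μ (N.energy q s ⁻¹' {k | 1 ≤ (k : ℕ)}) = ENNReal.ofReal (N.activeProb q) := by
    have h1 := sum_measureReal_preimage_singleton (μ := μ) (f := N.energy q s)
      (Finset.univ.filter fun k : Fin (P.B + 1) => 1 ≤ (k : ℕ))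
      (fun y _ => N.energy_measurable q hq s (measurableSet_singleton y))
    rw [Finset.sum_filter] at h1
    rw [← ofReal_measureReal, activeProb]
    congr 1
    rw [show {k : Fin (P.B + 1) | 1 ≤ (k : ℕ)} =
      ((Finset.univ.filter fun k : Fin (P.B + 1) => 1 ≤ (k : ℕ) : Finset _) : Set _) by
        ext; simp, ← h1]
    refine Finset.sum_congr rfl fun k _ => ?_
    rw [← N.energy_law q hq s k]
    rfl
  have ha : μ (N.access q s ⁻¹' {true}) = ENNReal.ofReal q := by
    rw [← ofReal_measureReal]
    exact congrArg ENNReal.ofReal (N.access_law q hq s)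
  rw [he, ha, ← ENNReal.ofReal_mul'  hq.1] at h
  exact h

/-- Laplace transform of the power received from a single interferer. -/
lemma lintegral_expNeg_markPower (N : Network P μ) [IsProbabilityMeasure μ] {q : ℝ}
    (hq : q ∈ Icc (0 : ℝ) 1) {c : ℝ} (hc : 0 ≤ c) (x : Plane) (s : ℕ) :
    ∫⁻ ω, expNeg (ENNReal.ofReal c * P.markPower N.receiver x (N.mark q s ω)) ∂μ =
      ENNReal.ofReal (1 - N.activeProb q * q + N.activeProb q * q *
        (1 / (1 + 2 * P.sigma ^ 2 * (c * dist x N.receiver ^ (-P.α))))) := by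
  set a := N.activeProb q * q with ha
  set y := dist x N.receiver ^ (-P.α) with hy
  have hy0 : 0 ≤ y := Real.rpow_nonneg dist_nonneg _
  have ha0 : 0 ≤ a := N.activeProb_mul_nonneg hq
  have ha1 : a ≤ 1 := (N.activeProb_mul_le hq).trans P.p_le_one
  let S : Set (Fin (P.B + 1) × Bool) := {m | 1 ≤ (m.1 : ℕ) ∧ m.2 = true}
  have hS : MeasurableSet S := MeasurableSet.of_discrete
  let Y : Ω → Fin (P.B + 1) × Bool := fun ω => (N.energy q s ω, N.access q s ω)
  have hY : Measurable Y := (N.energy_measurable q hq s).prodMk (N.access_measurable q hq s)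
  have hT : {ω | N.Transmits q s ω} = Y ⁻¹' S := rfl
  have hTm : MeasurableSet (Y ⁻¹' S) := hY hS
  let g : ℂ → ℝ≥0∞ := fun h => expNeg (ENNReal.ofReal (c * y * ‖h‖ ^ 2))
  have hg : Measurable g := by fun_prop
  -- A silent interferer contributes `exp 0 = 1`, an active one the transform of its fading.
  have hsplit : ∀ ω, expNeg (ENNReal.ofReal c * P.markPower N.receiver x (N.mark q s ω)) =
      g (N.fading s ω) * (S.indicator 1 (Y ω)) + (Y ⁻¹' S)ᶜ.indicator 1 ω := by
    intro ω
    by_cases h : Y ω ∈ S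
    · have h' : ω ∉ (Y ⁻¹' S)ᶜ := fun h' => h' h
      rw [indicator_of_mem h, indicator_of_notMem h', Params.markPower]
      rw [if_pos (show 1 ≤ ((N.mark q s ω).2.1 : ℕ) ∧ (N.mark q s ω).2.2 = true from h),
        Params.rxPower, ← ENNReal.ofReal_mul hc, ← mul_assoc]
      simp [g, mark, hy]
    · have h' : ω ∈ (Y ⁻¹' S)ᶜ := h
      rw [indicator_of_notMem h, indicator_of_mem h', Params.markPower]
      rw [if_neg (show ¬ (1 ≤ ((N.mark q s ω).2.1 : ℕ) ∧ (N.mark q s ω).2.2 = true) from h)]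
      simp
  have h1S : Measurable (S.indicator (1 : Fin (P.B + 1) × Bool → ℝ≥0∞)) :=
    measurable_one.indicator hS
  have hprod := lintegral_mul_eq_lintegral_mul_lintegral_of_indepFun
    (hg.comp (N.fading_measurable s)) (h1S.comp hY)
    ((N.indep_fading q hq s).comp hg h1S)
  have hray : ∫⁻ ω, g (N.fading s ω) ∂μ = ENNReal.ofReal (1 / (1 + 2 * P.sigma ^ 2 * (c * y))) := by
    rw [← lintegral_expNeg_sq_rayleighMeasure P.sigma_pos (mul_nonneg hc hy0),
      ← (N.fading_law s).lintegral_comp (by fun_prop)]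
  have hind : ∫⁻ ω, S.indicator 1 (Y ω) ∂μ = ENNReal.ofReal a := by
    rw [ha, ← N.measure_transmits hq s, hT, ← lintegral_indicator_one hTm]
    rfl
  have hcompl : μ (Y ⁻¹' S)ᶜ = ENNReal.ofReal (1 - a) := by
    rw [prob_compl_eq_one_sub hTm, ← hT, N.measure_transmits hq s, ← ha,
      ENNReal.ofReal_sub _ ha0, ENNReal.ofReal_one]
  simp_rw [hsplit]
  rw [lintegral_add_right _ (measurable_one.indicator hTm.compl),
    lintegral_indicator_one hTm.compl, hcompl]
  simp only [Pi.mul_apply, Function.comp] at hprod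
  have hpos : 0 ≤ 1 / (1 + 2 * P.sigma ^ 2 * (c * y)) := by positivity
  rw [hprod, hray, hind, ← ENNReal.ofReal_mul hpos,
    ← ENNReal.ofReal_add (mul_nonneg hpos ha0) (by linarith)]
  congr 1; ring

/-- Laplace transform of the interference. -/
lemma lintegral_expNeg_interference (N : Network P μ) [IsProbabilityMeasure μ] {q : ℝ}
    (hq : q ∈ Icc (0 : ℝ) 1) {c : ℝ} (hc : 0 ≤ c) :
    ∫⁻ ω, ∫⁻ ω', expNeg (ENNReal.ofReal c *
        ∑' s, P.markPower N.receiver (N.loc s ω) (N.mark q s ω')) ∂μ ∂μ =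
      expNeg (ENNReal.ofReal P.lam * ∫⁻ x : Plane, (1 - ENNReal.ofReal (1 - N.activeProb q * q +
        N.activeProb q * q * (1 / (1 + 2 * P.sigma ^ 2 * (c * dist x N.receiver ^ (-P.α))))))) := by
  set a := N.activeProb q * q with ha
  have ha0 : 0 ≤ a := N.activeProb_mul_nonneg hq
  let ψ : Plane → ℝ≥0∞ := fun x => ENNReal.ofReal (1 - a +
    a * (1 / (1 + 2 * P.sigma ^ 2 * (c * dist x N.receiver ^ (-P.α)))))
  have hψ1 : ∀ x, ψ x ≤ 1 := fun x => by
    have hy0 : 0 ≤ 2 * P.sigma ^ 2 * (c * dist x N.receiver ^ (-P.α)) := by positivity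
    have h1 : 1 / (1 + 2 * P.sigma ^ 2 * (c * dist x N.receiver ^ (-P.α))) ≤ 1 := by
      rw [div_le_one (by linarith)]; linarith
    refine ENNReal.ofReal_le_one.2 ?_
    nlinarith
  have hψm : Measurable ψ := by fun_prop
  -- With the locations frozen, the independent marks average to `∏ ψ(x_s)`; `g = -log ψ` makes this
  -- a Laplace functional in the locations.
  let g : Plane → ℝ≥0∞ := fun x => (-ENNReal.log (ψ x)).toENNReal
  have hg : Measurable g := by
    have : Measurable fun x => -ENNReal.log (ψ x) :=
      continuous_neg.measurable.comp (ENNReal.measurable_log.comp hψm)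
    exact this.ereal_toENNReal
  have hgψ : ∀ x, expNeg (g x) = ψ x := fun x => exists_expNeg_eq (hψ1 x)
  have hinner : ∀ ω, ∫⁻ ω', expNeg (ENNReal.ofReal c *
      ∑' s, P.markPower N.receiver (N.loc s ω) (N.mark q s ω')) ∂μ =
      expNeg (∑' s, g (N.loc s ω)) := fun ω => by
    simp_rw [← ENNReal.tsum_mul_left]
    have hm : ∀ s, Measurable fun m : ℂ × Fin (P.B + 1) × Bool =>
        ENNReal.ofReal c * P.markPower N.receiver (N.loc s ω) m := fun s =>
      ((P.measurable_markPower N.receiver).comp measurable_prodMk_left).const_mul _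
    refine lintegral_expNeg_tsum_of_iIndepFun (fun s => (hm s).comp (N.measurable_mark hq s))
      ((N.indep_marks q hq).comp _ hm) fun s => ?_
    rw [hgψ]
    exact N.lintegral_expNeg_markPower hq hc (N.loc s ω) s
  simp_rw [hinner]
  rw [N.loc_poisson.lintegral_expNeg_tsum hg]
  simp_rw [hgψ]
  rfl

/-- For fixed interference, the success probability decays exponentially in it. -/
lemma measure_lt_rxPower_div (N : Network P μ) [IsProbabilityMeasure μ] (i : ℝ≥0∞) :
    μ {ω | ENNReal.ofReal P.θ < P.rxPower P.d (N.ownFading ω) / i} =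
      expNeg (ENNReal.ofReal (P.θ * P.d ^ P.α / (2 * P.sigma ^ 2)) * i) := by
  have hd := P.d_pos
  have hθ := P.θ_pos
  have hs := P.sigma_pos
  have hdα : 0 < P.d ^ P.α := Real.rpow_pos_of_pos hd _
  induction i using ENNReal.recTopCoe with
  -- Infinite interference makes the ratio `0`, and the positive constant makes the right side `0`
  -- as well.
  | top =>
    rw [ENNReal.mul_top (by simpa using by positivity)]
    simp
  | coe t =>
    have hset : {ω | ENNReal.ofReal P.θ < P.rxPower P.d (N.ownFading ω) / t} =
        {ω | P.θ * P.d ^ P.α * t < ‖N.ownFading ω‖ ^ 2} := by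
      ext ω
      simp only [mem_ofPred_eq]
      rw [ENNReal.lt_div_iff_mul_lt (Or.inr (by simp)) (Or.inl (by simp)),
        Params.rxPower, ← ENNReal.ofReal_coe_nnreal, ← ENNReal.ofReal_mul hθ.le,
        ENNReal.ofReal_lt_ofReal_iff_of_nonneg (by positivity), Real.rpow_neg hd.le,
        lt_inv_mul_iff₀ hdα]
      rw [show P.d ^ P.α * (P.θ * t) = P.θ * P.d ^ P.α * t by ring]
    have hm : MeasurableSet {x : ℝ | P.θ * P.d ^ P.α * t < x ^ 2} :=
      measurableSet_lt measurable_const (by fun_prop)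
    rw [hset, N.ownFading_law.measure_eq hm, rayleighMeasure_setOf_lt_sq hs (by positivity),
      ← ENNReal.ofReal_coe_nnreal, ← ENNReal.ofReal_mul (by positivity),
      expNeg_ofReal (by positivity)]
    congr 3; ring

/-- Away from `z` the integrand is `a T / (|x - z|^α + T)`, so translation and polar coordinates
reduce it to the radial integral; `2π` times the constant found there is `κ(α)`. -/
lemma lintegral_one_sub_plane (P : Params) (z : Plane) {a : ℝ} (ha : 0 ≤ a) (ha1 : a ≤ 1) {T : ℝ} (hT : 0 < T) :
    ∫⁻ x : Plane, (1 - ENNReal.ofReal (1 - a + a * (1 / (1 + T * dist x z ^ (-P.α))))) =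
      ENNReal.ofReal (a * T ^ (2 / P.α) * P.kappa) := by
  have hα := P.two_lt_α
  have hα0 : 0 < P.α := by linarith
  have hsin : 0 < Real.sin (2 * Real.pi / P.α) := by
    refine Real.sin_pos_of_pos_of_lt_pi (by positivity) ?_
    rw [div_lt_iff₀ hα0]; nlinarith [Real.pi_pos]
  let f : ℝ → ℝ := fun y => T / (y ^ P.α + T)
  have hf : ∀ y, 0 < y → 0 ≤ f y := fun y hy => by positivity
  have hfm : Measurable f := by fun_prop
  -- The point `z` has to be dropped: there the convention `0 ^ (-α) = 0` makes the left side `0`,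
  -- while the right side is `a`.
  have hae : ∀ᵐ x : Plane, 1 - ENNReal.ofReal (1 - a + a * (1 / (1 + T * dist x z ^ (-P.α)))) =
      ENNReal.ofReal a * ENNReal.ofReal (f ‖x - z‖) := by
    filter_upwards [compl_mem_ae_iff.2 (measure_singleton z)] with x hx
    have hr : 0 < ‖x - z‖ := norm_pos_iff.2 (sub_ne_zero.2 hx)
    have hrα : 0 < ‖x - z‖ ^ P.α := Real.rpow_pos_of_pos hr _
    rw [← ENNReal.ofReal_mul ha, dist_eq_norm, Real.rpow_neg hr.le]
    have h1 : a * f ‖x - z‖ = 1 - (1 - a + a * (1 / (1 + T * (‖x - z‖ ^ P.α)⁻¹))) := by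
      simp only [f]; field_simp; ring
    have h2 : 0 ≤ a * (1 / (1 + T * (‖x - z‖ ^ P.α)⁻¹)) := by positivity
    rw [h1, ENNReal.ofReal_sub _ (by linarith), ENNReal.ofReal_one]
  have hI := lintegral_Ioi_div_rpow_add hα hT
  rw [lintegral_congr_ae hae, lintegral_const_mul _ (by fun_prop),
    lintegral_sub_right_eq_self (fun x : Plane => ENNReal.ofReal (f ‖x‖)) z,
    lintegral_plane_norm hf hfm (by rw [hI]; simp), hI, ← ENNReal.ofReal_mul (by positivity),
    ← ENNReal.ofReal_mul ha, Params.kappa]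
  congr 1; ring

lemma measurable_tsum_markPower (P : Params) (z : Plane) :
    Measurable fun x : (ℕ → Plane) × (ℕ → ℂ × Fin (P.B + 1) × Bool) =>
      ∑' s, P.markPower z (x.1 s) (x.2 s) := by
  refine Measurable.tsum fun s => ?_
  have h : Measurable fun x : (ℕ → Plane) × (ℕ → ℂ × Fin (P.B + 1) × Bool) => (x.1 s, x.2 s) := by
    fun_prop
  exact (P.measurable_markPower z).comp h

/-- Fubini twice: the locations are independent of all the rest, and the link's own fading is
independent of the marks. Integrating out that fading first leaves an exponential of the
interference. -/
lemma measure_lt_SIR (N : Network P μ) [IsProbabilityMeasure μ] {q : ℝ}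
    (hq : q ∈ Icc (0 : ℝ) 1) :
    μ {ω | ENNReal.ofReal P.θ < N.SIR q ω} =
      ∫⁻ ω, ∫⁻ ω', expNeg (ENNReal.ofReal (P.θ * P.d ^ P.α / (2 * P.sigma ^ 2)) *
        ∑' s, P.markPower N.receiver (N.loc s ω) (N.mark q s ω')) ∂μ ∂μ := by
  let L : Ω → ℕ → Plane := fun ω s => N.loc s ω
  let M : Ω → ℕ → ℂ × Fin (P.B + 1) × Bool := fun ω s => N.mark q s ω
  have hL : Measurable L := measurable_pi_lambda _ N.loc_poisson.measurable
  have hM : Measurable M := measurable_pi_lambda _ fun s => N.measurable_mark hq s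
  let S : Set ((ℕ → Plane) × ℂ × (ℕ → ℂ × Fin (P.B + 1) × Bool)) :=
    {x | ENNReal.ofReal P.θ < P.rxPower P.d x.2.1 / ∑' s, P.markPower N.receiver (x.1 s) (x.2.2 s)}
  have hS : MeasurableSet S := by
    refine measurableSet_lt measurable_const (Measurable.div ?_ ?_)
    · unfold Params.rxPower
      fun_prop
    · exact (measurable_tsum_markPower P N.receiver).comp
        (measurable_fst.prodMk (measurable_snd.comp measurable_snd))
  have hf : Measurable
      (S.indicator (1 : (ℕ → Plane) × ℂ × (ℕ → ℂ × Fin (P.B + 1) × Bool) → ℝ≥0∞)) := measurable_one.indicator hS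
  have hYm : Measurable fun ω => (N.ownFading ω, M ω) := N.ownFading_measurable.prodMk hM
  have hset : {ω | ENNReal.ofReal P.θ < N.SIR q ω} =
      (fun ω => (L ω, N.ownFading ω, M ω)) ⁻¹' S := by
    ext ω
    simp only [mem_ofPred_eq, SIR, interference_eq]
    rfl
  rw [hset, ← lintegral_indicator_one ((hL.prodMk hYm) hS)]
  refine (lintegral_comp_of_indepFun (N.indep_loc q hq) hL hYm hf).trans ?_
  refine lintegral_congr fun ω => ?_
  have hswap : Measurable fun x : (ℕ → ℂ × Fin (P.B + 1) × Bool) × ℂ => (L ω, x.2, x.1) := by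
    fun_prop
  refine (lintegral_comp_of_indepFun (N.indep_ownFading q hq).symm hM N.ownFading_measurable
    (hf.comp hswap)).trans ?_
  refine lintegral_congr fun ω' => ?_
  rw [← N.measure_lt_rxPower_div, ← lintegral_indicator_one]
  · rfl
  · exact (hswap.comp (measurable_prodMk_left.comp N.ownFading_measurable)) hS

theorem successProb_eq (N : Network P μ) [IsProbabilityMeasure μ] {q : ℝ}
    (hq : q ∈ Icc (0 : ℝ) 1) :
    N.successProb q = Real.exp (-(N.activeProb q * q * P.lam / P.lamMax)) := by
  have hd := P.d_pos
  have hθ := P.θ_pos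
  have hs := P.sigma_pos
  have hα := P.two_lt_α
  have hα0 : 0 < P.α := by linarith
  have hdα : 0 < P.d ^ P.α := Real.rpow_pos_of_pos hd _
  have ha0 := N.activeProb_mul_nonneg hq
  have ha1 := (N.activeProb_mul_le hq).trans P.p_le_one
  have hκ : 0 < P.kappa := by
    have hsin : 0 < Real.sin (2 * Real.pi / P.α) := by
      refine Real.sin_pos_of_pos_of_lt_pi (by positivity) ?_
      rw [div_lt_iff₀ hα0]; nlinarith [Real.pi_pos]
    unfold Params.kappa
    positivity
  -- The fading scale cancels, since signal and interference share it; what is left is `T = θ d^α`.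
  have hT : ∀ y : ℝ, 2 * P.sigma ^ 2 * (P.θ * P.d ^ P.α / (2 * P.sigma ^ 2) * y) =
      P.θ * P.d ^ P.α * y := fun y => by field_simp
  have hpow : (P.θ * P.d ^ P.α) ^ (2 / P.α) = P.θ ^ (2 / P.α) * P.d ^ 2 := by
    rw [Real.mul_rpow hθ.le hdα.le, ← Real.rpow_mul hd.le, mul_div_cancel₀ _ hα0.ne']
    norm_num
  rw [successProb, measureReal_def, N.measure_lt_SIR hq,
    N.lintegral_expNeg_interference hq (by positivity)]
  simp_rw [hT]
  rw [lintegral_one_sub_plane P N.receiver ha0 ha1 (by positivity), hpow,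
    ← ENNReal.ofReal_mul P.lam_pos.le, expNeg_ofReal, ENNReal.toReal_ofReal (Real.exp_pos _).le]
  · congr 1
    rw [Params.lamMax]
    field_simp
  · have := P.lam_pos
    positivity

/-! ### Best replies and equilibria. -/

theorem throughput_eq (N : Network P μ) [IsProbabilityMeasure μ] {q : ℝ}
    (hq : q ∈ Icc (0 : ℝ) 1) (x : ℝ) : N.throughput x q =
      N.activeProb x * x * (Real.exp (-(N.activeProb q * q * P.lam / P.lamMax)) * P.R) := by
  rw [throughput, N.successProb_eq hq, mul_assoc]

/-- Every transmitter spends all its energy in a symmetric Nash equilibrium. -/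
lemma IsSNE.activeProb_mul_eq {N : Network P μ} [IsProbabilityMeasure μ] {q : ℝ}
    (h : N.IsSNE q) : N.activeProb q * q = P.p := by
  refine (N.activeProb_mul_le h.1).antisymm ?_
  have h1 := h.2 1 (by simp)
  rw [N.throughput_eq h.1, N.throughput_eq h.1, N.activeProb_one_mul] at h1
  exact le_of_mul_le_mul_right h1 (mul_pos (Real.exp_pos _) P.R_pos)

end Network

end EHAloha

end

theorem theorem4 (P : EHAloha.Params) {Ω : Type*} [MeasurableSpace Ω] (μ : Measure Ω)
    [IsProbabilityMeasure μ] (N : EHAloha.Network P μ) :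
    N.IsSNE 1 ∧
      ∀ q : ℝ, N.IsSNE q →
        N.throughput q q = P.p * Real.exp (-(P.p * P.lam / P.lamMax)) * P.R ∧
        N.capacity q = P.lam * P.p * Real.exp (-(P.p * P.lam / P.lamMax)) * P.R := by
  have h1 : (1 : ℝ) ∈ Icc (0 : ℝ) 1 := by simp
  refine ⟨⟨h1, fun x hx => ?_⟩, fun q hq => ?_⟩
  · rw [N.throughput_eq h1, N.throughput_eq h1, N.activeProb_one_mul]
    exact mul_le_mul_of_nonneg_right (N.activeProb_mul_le hx)
      (mul_pos (Real.exp_pos _) P.R_pos).le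
  · have h : N.throughput q q = P.p * Real.exp (-(P.p * P.lam / P.lamMax)) * P.R := by
      rw [N.throughput_eq hq.1, hq.activeProb_mul_eq, mul_assoc]
    exact ⟨h, by rw [EHAloha.Network.capacity, h]; ring⟩
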